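/- **Setting (de Bruijn $\pi$-calculus).** A context $\Gamma$ is a natural number, its names are $0,\dots,\Gamma-1$, and $\mathrm{Proc}\,\Gamma$ is the set of processes $P,Q ::= 0 \mid \underline{x}.P \mid \overline{x}\langle y\rangle.P \mid P+Q \mid P\,|\,Q \mid \nu P \mid\, !P$ with free names in $\Gamma$, where input and $\nu$ bind the index $0$ (their bodies are in $\Gamma+1$). Actions over $\Gamma$ are bound, $b ::= \underline{x} \mid \overline{x}$ (input, bound output; $|b|=1$), or non-bound, $c ::= \overline{x}\langle y\rangle \mid \tau$ ($|c|=0$); $a$ ranges over all actions. A renaming $\rho:\Gamma\to\Delta$ is any function on names; it acts on processes and actions by $\rho^*$, going under a binder as $\rho+1$ ($0\mapsto 0$, $x+1\mapsto \rho x+1$). Put $\mathsf{push}\,x=x+1$; $\mathsf{pop}_y\,0=y$, $\mathsf{pop}_y(x+1)=x$; $\mathsf{swap}$ exchanges $0$ and $1$. Transitions $t:P\xrightarrow{a}R$, with $P\in\mathrm{Proc}\,\Gamma$ and $R\in\mathrm{Proc}(\Gamma+|a|)$, are the derivations by the following rules and their left-right mirror images (the term to the left of each colon names the derivation). - $\underline{x}.P\xrightarrow{\underline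 x}P$ and $\overline{x}\langle y\rangle.P\xrightarrow{\overline{x}\langle y\rangle}P$. - If $t:P\xrightarrow{a}R$, then $t+Q: P+Q\xrightarrow{a}R$. If $t:P\,|\,!P\xrightarrow{a}R$, then $!t:\,!P\xrightarrow{a}R$. - If $t:P\xrightarrow{a}R$, then $t\,|^aQ:P\,|\,Q\xrightarrow{a}R\,|\,Q'$ with $Q'=Q$ for non-bound $a$, and $Q'=\mathsf{push}^*Q$ for bound $a$. (Mirror image: $P\,|^a u$.) - If $t:P\xrightarrow{\underline x}R$ and $u:Q\xrightarrow{\overline x\langle y\rangle}S$, then $t\,|_y\,u:P\,|\,Q\xrightarrow{\tau}\mathsf{pop}_y^*R\,|\,S$. - If $t:P\xrightarrow{\underline x}R$ and $u:Q\xrightarrow{\overline x}S$, then $t\,|_\nu\,u:P\,|\,Q\xrightarrow{\tau}\nu(R\,|\,S)$ (a $\nu$-synchronisation). - If $t:P\xrightarrow{\overline{x+1}\langle 0\rangle}R$, then $\bar\nu t:\nu P\xrightarrow{\overline x}R$. - If $t:P\xrightarrow{\mathsf{push}^*a}R$, then $\nu^a t:\nu P\xrightarrow{a}\nu R'$ with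 $R'=R$ for non-bound $a$, and $R'=\mathsf{swap}^*R$ for bound $a$. Every transition $t:P\xrightarrow{a}R$ has an image $\rho^*t:\rho^*P\xrightarrow{\rho^*a}(\rho+|a|)^*R$. **Concurrent actions** $\mathbf a:a\smile a'$, with residual actions $a'/a$ and $a/a'$, are of one of these kinds (closed under symmetry): (i) $c\smile c'$, with residuals $c',\,c$; (ii) $b\smile c$, with residuals $\mathsf{push}^*c,\,b$; (iii) $b\smile b'$, with residuals $\mathsf{push}^*b',\,\mathsf{push}^*b$; (iv) $\overline x\smile\overline y$, two extrusions of the same binder, with residuals $\overline{y+1}\langle0\rangle,\ \overline{x+1}\langle0\rangle$; (v) $\tau\smile\tau$, two $\nu$-synchronisations of distinct binders, with residuals $\tau,\tau$. **Concurrent transitions.** $t\smile t'$, with concurrent actions $\mathbf a$ (always of kind (i)-(iii) unless said otherwise), is the least symmetric relation on coinitial transitions closed under the following rules and their left-right mirror images. - $P\,|^{a}u\smile t\,|^{a'}Q$ always. - If $t\smile t'$, then $t\,|^aQ\smile s$, where $s$ is any synchronisation or $\nu$-synchronisation, in either direction, of $t'$ with a transition of $Q$. - If $t\smile t'$ and $u\smile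 u'$, then $s\smile s'$, where $s$ is a synchronisation or $\nu$-synchronisation, in either direction, of $t$ with $u$, and $s'$ one of $t'$ with $u'$. If $s$ and $s'$ are both $\nu$-synchronisations and neither premise has kind (iv), this has kind (v). - If $t\smile t'$, then $t+Q\smile t'+Q$, $\ t\,|^aQ\smile t'\,|^{a'}Q$, $\ \nu^at\smile\nu^{a'}t'$ and $!t\smile\,!t'$, each of the same kind as $t\smile t'$. - If $t\smile t'$, then $\bar\nu t\smile\nu^{a}t'$, and $\bar\nu t\smile\bar\nu t'$, the latter of kind (iv). **Residuals.** The residual $t'/t$ of $t\smile t'$ is a transition from the target of $t$ with action $a'/a$, and $t/t'$ is one from the target of $t'$ with action $a/a'$. They are defined by recursion, as follows (up to left-right mirror images). Here $[\mathsf{push}^*]v$ means $\mathsf{push}^*v$ if the action of the transition taken first is bound and $v$ otherwise, and in a synchronisation the transmitted name is shifted by $\mathsf{push}$ when the residual of its output is. - $(P|^au)/(t|^{a'}Q)=\mathrm{tgt}(t)\,|^{a/a'}\,[\mathsf{push}^*]u$. - $(t|^aQ)/(t'|^{a'}Q)=(t/t')\,|^{a/a'}\,[\mathsf{push}^*]Q$;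 $\ (t+Q)/(t'+Q)=t/t'$; $\ (!t)/(!t')=t/t'$. - $(t|^aQ)/(t'|_yu)=\mathsf{pop}_y^*(t/t')\,|^a\,\mathrm{tgt}(u)$ and $(P|^au)/(t|_yu')=\mathsf{pop}_y^*\mathrm{tgt}(t)\,|^a\,(u/u')$. - $(t|^aQ)/(t'|_\nu u)=\nu^a((t/t')\,|\,\mathrm{tgt}(u))$ and $(P|^au)/(t|_\nu u')=\nu^a(\mathrm{tgt}(t)\,|\,(u/u'))$, with $\bar\nu$ in place of $\nu^a$ if the premise has kind (iv). - A (plain or $\nu$-) synchronisation of $t,u$ after $t'|^{a'}Q$ is the synchronisation of $t/t'$ and $[\mathsf{push}^*]u$. It is a $\nu$-synchronisation iff the original one was, except that it is a plain one transmitting $0$ if the premise has kind (iv). - A (plain or $\nu$-) synchronisation of $t,u$ after one of $t',u'$ is the synchronisation $r$ of $t/t'$ and $u/u'$, where the residual of the component on the receiving side of a plain first synchronisation transmitting $z$ is replaced by its image under $\mathsf{pop}_z^*$; if the first one is a $\nu$-synchronisation the result is $\nu^\tau r$. It is a $\nu$-synchronisation iff the original one was, except that it is a plain one transmitting $0$ if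 a premise has kind (iv). - $\bar\nu t/\bar\nu t'=t/t'$; $\ \nu^at/\bar\nu t'=t/t'$; $\ \bar\nu t/\nu^{c}t'=\bar\nu(t/t')$; $\ \bar\nu t/\nu^{b}t'=\bar\nu(\mathsf{swap}^*(t/t'))$; $\ \nu^at/\nu^{c}t'=\nu^{a/c}(t/t')$; $\ \nu^at/\nu^{b}t'=\nu^{a/b}(\mathsf{swap}^*(t/t'))$. **Braidings.** A *free braid* between $P,R\in\mathrm{Proc}(\Gamma+2)$ is the fact $P=\mathsf{swap}^*R$. A *bound braid* between $P,R\in\mathrm{Proc}\,\Gamma$ is a derivation from the axiom $\nu\nu P_0\rtimes\nu\nu R_0$ (for a free braid $P_0=\mathsf{swap}^*R_0$) by closure under the contexts $\cdot+Q$, $Q+\cdot$, $\cdot\,|\,Q$, $Q\,|\,\cdot$, $\nu\,\cdot$ and $!\,\cdot$; it transposes one pair of adjacent $\nu$-binders, at the position where the axiom is used. The braidings $Q\bowtie_{\mathbf a}Q'$ are: equality $Q=Q'$ for kinds (i), (ii), (iv); free braids for kind (iii); bound braids for kind (v). **Theorem (Cofinality of residuals).** Let $t:P\xrightarrow{a}R$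 and $t':P\xrightarrow{a'}R'$ be concurrent, $t\smile t'$, with concurrent actions $\mathbf a:a\smile a'$. Then there is a unique braiding $$\gamma_{t,t'}:\ \mathrm{tgt}(t'/t)\ \bowtie_{\mathbf a}\ \mathrm{tgt}(t/t'),$$ where, for $\mathbf a$ of kind (v), $\gamma_{t,t'}$ is the unique bound braid that transposes the pair of $\nu$-binders put back by the two $\nu$-synchronisations. -/

import Mathlib

/-! # A de Bruijn π-calculus: proved transitions, concurrency, residuals, braidings -/

namespace PiCalc

/-- Processes closed by the context `Γ` (a natural number; names are elements of `Fin Γ`). -/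
inductive Proc : ℕ → Type
  | zero {Γ : ℕ} : Proc Γ
  | inp {Γ : ℕ} (x : Fin Γ) (P : Proc (Γ + 1)) : Proc Γ
  | out {Γ : ℕ} (x y : Fin Γ) (P : Proc Γ) : Proc Γ
  | choice {Γ : ℕ} (P Q : Proc Γ) : Proc Γ
  | par {Γ : ℕ} (P Q : Proc Γ) : Proc Γ
  | nu {Γ : ℕ} (P : Proc (Γ + 1)) : Proc Γ
  | rep {Γ : ℕ} (P : Proc Γ) : Proc Γ

/-- Bound actions: input `x` and bound output `x̄`. -/
inductive BAct (Γ : ℕ) : Type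
  | inp (x : Fin Γ) : BAct Γ
  | bout (x : Fin Γ) : BAct Γ

/-- Non-bound actions: output `x̄⟨y⟩` and `τ`. -/
inductive CAct (Γ : ℕ) : Type
  | out (x y : Fin Γ) : CAct Γ
  | tau : CAct Γ

/-- Actions. -/
inductive Act (Γ : ℕ) : Type
  | bd (b : BAct Γ) : Act Γ
  | nb (c : CAct Γ) : Act Γ

/-- `|a|`: the amount by which the action `a` increments the context. -/
@[reducible] def Act.size {Γ : ℕ} : Act Γ → ℕ
  | .bd _ => 1
  | .nb _ => 0

/-! ## Renamings -/

/-- The action of `· + 1` on renamings. -/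
def lift {Γ Δ : ℕ} (ρ : Fin Γ → Fin Δ) : Fin (Γ + 1) → Fin (Δ + 1) :=
  Fin.cases 0 (fun x => (ρ x).succ)

def push {Γ : ℕ} : Fin Γ → Fin (Γ + 1) := Fin.succ

def pop {Γ : ℕ} (y : Fin Γ) : Fin (Γ + 1) → Fin Γ := Fin.cases y (fun x => x)

def swap {Γ : ℕ} : Fin (Γ + 2) → Fin (Γ + 2) :=
  Fin.cases 1 (Fin.cases 0 (fun x => x.succ.succ))

def Proc.ren {Γ Δ : ℕ} (ρ : Fin Γ → Fin Δ) : Proc Γ → Proc Δ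
  | .zero => .zero
  | .inp x P => .inp (ρ x) (P.ren (lift ρ))
  | .out x y P => .out (ρ x) (ρ y) (P.ren ρ)
  | .choice P Q => .choice (P.ren ρ) (Q.ren ρ)
  | .par P Q => .par (P.ren ρ) (Q.ren ρ)
  | .nu P => .nu (P.ren (lift ρ))
  | .rep P => .rep (P.ren ρ)

def BAct.ren {Γ Δ : ℕ} (ρ : Fin Γ → Fin Δ) : BAct Γ → BAct Δ
  | .inp x => .inp (ρ x)
  | .bout x => .bout (ρ x)

def CAct.ren {Γ Δ : ℕ} (ρ : Fin Γ → Fin Δ) : CAct Γ → CAct Δ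
  | .out x y => .out (ρ x) (ρ y)
  | .tau => .tau

def Act.ren {Γ Δ : ℕ} (ρ : Fin Γ → Fin Δ) : Act Γ → Act Δ
  | .bd b => .bd (b.ren ρ)
  | .nb c => .nb (c.ren ρ)

/-- `ρ + |a|`, a renaming between the target contexts of `a` and of `ρ* a`. -/
def Act.lift {Γ Δ : ℕ} (ρ : Fin Γ → Fin Δ) :
    (a : Act Γ) → Fin (Γ + a.size) → Fin (Δ + (a.ren ρ).size)
  | .bd _ => PiCalc.lift ρ
  | .nb _ => ρ

/-- What becomes of the idle component of a parallel composition when `a` propagates past it: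
`push* Q` if `a` is bound, and `Q` otherwise. -/
def Act.shift {Γ : ℕ} : (a : Act Γ) → Proc Γ → Proc (Γ + a.size)
  | .bd _, Q => Q.ren push
  | .nb _, Q => Q

/-- The target of `a` after propagating through a `ν`-binder, where `R` is the target of
`push* a`: `ν (swap* R)` if `a` is bound, and `ν R` otherwise. -/
def Act.close {Γ : ℕ} : (a : Act Γ) → Proc (Γ + 1 + (a.ren push).size) → Proc (Γ + a.size)
  | .bd _, R => .nu (Proc.ren swap R)
  | .nb _, R => .nu R

/-! ## Transitions -/

/-- `Trans P a R`: the (proof-relevant) transitions `P —a→ R`. -/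
inductive Trans : {Γ : ℕ} → Proc Γ → (a : Act Γ) → Proc (Γ + a.size) → Type
  | inp {Γ : ℕ} (x : Fin Γ) (P : Proc (Γ + 1)) : Trans (.inp x P) (.bd (.inp x)) P
  | out {Γ : ℕ} (x y : Fin Γ) (P : Proc Γ) : Trans (.out x y P) (.nb (.out x y)) P
  | choiceL {Γ : ℕ} {P : Proc Γ} {a : Act Γ} {R : Proc (Γ + a.size)}
      (t : Trans P a R) (Q : Proc Γ) : Trans (.choice P Q) a R
  | choiceR {Γ : ℕ} {Q : Proc Γ} {a : Act Γ} {S : Proc (Γ + a.size)}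
      (P : Proc Γ) (u : Trans Q a S) : Trans (.choice P Q) a S
  | parL {Γ : ℕ} {P : Proc Γ} {a : Act Γ} {R : Proc (Γ + a.size)}
      (t : Trans P a R) (Q : Proc Γ) : Trans (.par P Q) a (.par R (a.shift Q))
  | parR {Γ : ℕ} {Q : Proc Γ} {a : Act Γ} {S : Proc (Γ + a.size)}
      (P : Proc Γ) (u : Trans Q a S) : Trans (.par P Q) a (.par (a.shift P) S)
  | tauL {Γ : ℕ} {P Q : Proc Γ} {x y : Fin Γ} {R : Proc (Γ + 1)} {S : Proc Γ}
      (t : Trans P (.bd (.inp x)) R) (u : Trans Q (.nb (.out x y)) S) :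
      Trans (.par P Q) (.nb .tau) (.par (R.ren (pop y)) S)
  | tauR {Γ : ℕ} {P Q : Proc Γ} {x y : Fin Γ} {R : Proc Γ} {S : Proc (Γ + 1)}
      (t : Trans P (.nb (.out x y)) R) (u : Trans Q (.bd (.inp x)) S) :
      Trans (.par P Q) (.nb .tau) (.par R (S.ren (pop y)))
  | extrude {Γ : ℕ} {P : Proc (Γ + 1)} {x : Fin Γ} {R : Proc (Γ + 1)}
      (t : Trans P (.nb (.out x.succ 0)) R) : Trans (.nu P) (.bd (.bout x)) R
  | nuL {Γ : ℕ} {P Q : Proc Γ} {x : Fin Γ} {R S : Proc (Γ + 1)}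
      (t : Trans P (.bd (.inp x)) R) (u : Trans Q (.bd (.bout x)) S) :
      Trans (.par P Q) (.nb .tau) (.nu (.par R S))
  | nuR {Γ : ℕ} {P Q : Proc Γ} {x : Fin Γ} {R S : Proc (Γ + 1)}
      (t : Trans P (.bd (.bout x)) R) (u : Trans Q (.bd (.inp x)) S) :
      Trans (.par P Q) (.nb .tau) (.nu (.par R S))
  | nu {Γ : ℕ} {P : Proc (Γ + 1)} (a : Act Γ) {R : Proc (Γ + 1 + (a.ren push).size)}
      (t : Trans P (a.ren push) R) : Trans (.nu P) a (a.close R)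
  | rep {Γ : ℕ} {P : Proc Γ} {a : Act Γ} {R : Proc (Γ + a.size)}
      (t : Trans (.par P (.rep P)) a R) : Trans (.rep P) a R

/-! ### Renaming laws, and the image of a transition under a renaming -/

theorem lift_comp {Γ Δ Θ : ℕ} (σ : Fin Δ → Fin Θ) (ρ : Fin Γ → Fin Δ) :
    lift σ ∘ lift ρ = lift (σ ∘ ρ) := by
  funext i
  refine Fin.cases rfl (fun x => rfl) i

theorem Proc.ren_ren {Γ Δ Θ : ℕ} (σ : Fin Δ → Fin Θ) (ρ : Fin Γ → Fin Δ) (P : Proc Γ) :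
    (P.ren ρ).ren σ = P.ren (σ ∘ ρ) := by
  induction P generalizing Δ Θ with
  | zero => rfl
  | inp x P ih => simp only [Proc.ren, ih, lift_comp, Function.comp]
  | out x y P ih => simp only [Proc.ren, ih, Function.comp]
  | choice P Q ihP ihQ => simp only [Proc.ren, ihP, ihQ]
  | par P Q ihP ihQ => simp only [Proc.ren, ihP, ihQ]
  | nu P ih => simp only [Proc.ren, ih, lift_comp]
  | rep P ih => simp only [Proc.ren, ih]

theorem push_comm {Γ Δ : ℕ} (ρ : Fin Γ → Fin Δ) : lift ρ ∘ push = push ∘ ρ := rfl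

theorem pop_comm {Γ Δ : ℕ} (ρ : Fin Γ → Fin Δ) (y : Fin Γ) :
    ρ ∘ pop y = pop (ρ y) ∘ lift ρ := by
  funext i
  refine Fin.cases rfl (fun x => rfl) i

theorem swap_comm {Γ Δ : ℕ} (ρ : Fin Γ → Fin Δ) :
    swap ∘ lift (lift ρ) = lift (lift ρ) ∘ swap := by
  funext i
  refine Fin.cases rfl (fun x => Fin.cases rfl (fun z => rfl) x) i

theorem BAct.ren_ren {Γ Δ Θ : ℕ} (σ : Fin Δ → Fin Θ) (ρ : Fin Γ → Fin Δ) (b : BAct Γ) :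
    (b.ren ρ).ren σ = b.ren (σ ∘ ρ) := by
  cases b <;> rfl

theorem CAct.ren_ren {Γ Δ Θ : ℕ} (σ : Fin Δ → Fin Θ) (ρ : Fin Γ → Fin Δ) (c : CAct Γ) :
    (c.ren ρ).ren σ = c.ren (σ ∘ ρ) := by
  cases c <;> rfl

theorem BAct.push_pop {Γ : ℕ} (b : BAct Γ) (y : Fin Γ) : (b.ren push).ren (pop y) = b := by
  cases b <;> rfl

theorem CAct.push_pop {Γ : ℕ} (c : CAct Γ) (y : Fin Γ) : (c.ren push).ren (pop y) = c := by
  cases c <;> rfl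

theorem BAct.push_push_swap {Γ : ℕ} (b : BAct Γ) :
    ((b.ren push).ren push).ren swap = (b.ren push).ren push := by
  cases b <;> rfl

theorem CAct.push_push_swap {Γ : ℕ} (c : CAct Γ) :
    ((c.ren push).ren push).ren swap = (c.ren push).ren push := by
  cases c <;> rfl

/-- Transport of a transition along equations between its indices. -/
def Trans.castB {Γ : ℕ} {P : Proc Γ} {b b' : BAct Γ} {R R' : Proc (Γ + 1)}
    (t : Trans P (.bd b) R) (hb : b = b') (hR : R = R') : Trans P (.bd b') R' := by
  subst hb; subst hR; exact t

/-- Transport of a transition along equations between its indices. -/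
def Trans.castC {Γ : ℕ} {P : Proc Γ} {c c' : CAct Γ} {R R' : Proc Γ}
    (t : Trans P (.nb c) R) (hc : c = c') (hR : R = R') : Trans P (.nb c') R' := by
  subst hc; subst hR; exact t

/-- Transport of a transition along an equation between targets. -/
def Trans.castT {Γ : ℕ} {P : Proc Γ} {a : Act Γ} {R R' : Proc (Γ + a.size)}
    (t : Trans P a R) (hR : R = R') : Trans P a R' := by
  subst hR; exact t

theorem Act.shift_ren {Γ Δ : ℕ} (ρ : Fin Γ → Fin Δ) (a : Act Γ) (Q : Proc Γ) :
    (a.ren ρ).shift (Q.ren ρ) = (a.shift Q).ren (a.lift ρ) := by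
  cases a with
  | bd b =>
    change (Q.ren ρ).ren push = (Q.ren push).ren (PiCalc.lift ρ)
    rw [Proc.ren_ren, Proc.ren_ren, push_comm]
  | nb c => rfl

theorem Proc.ren_pop {Γ Δ : ℕ} (ρ : Fin Γ → Fin Δ) (y : Fin Γ) (R : Proc (Γ + 1)) :
    (R.ren (lift ρ)).ren (pop (ρ y)) = (R.ren (pop y)).ren ρ := by
  rw [Proc.ren_ren, Proc.ren_ren, pop_comm]

theorem Proc.ren_swap {Γ Δ : ℕ} (ρ : Fin Γ → Fin Δ) (R : Proc (Γ + 2)) :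
    (R.ren (lift (lift ρ))).ren swap = (R.ren swap).ren (lift (lift ρ)) := by
  rw [Proc.ren_ren, Proc.ren_ren, swap_comm]

/-- The image `ρ* t : ρ* P —(ρ* a)→ (ρ + |a|)* R` of a transition `t : P —a→ R`. -/
def Trans.ren : {Γ Δ : ℕ} → {P : Proc Γ} → {a : Act Γ} → {R : Proc (Γ + a.size)} →
    (ρ : Fin Γ → Fin Δ) → Trans P a R → Trans (P.ren ρ) (a.ren ρ) (R.ren (a.lift ρ))
  | _, _, _, _, _, ρ, .inp x P => .inp (ρ x) (P.ren (PiCalc.lift ρ))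
  | _, _, _, _, _, ρ, .out x y P => .out (ρ x) (ρ y) (P.ren ρ)
  | _, _, _, _, _, ρ, .choiceL t Q => .choiceL (t.ren ρ) (Q.ren ρ)
  | _, _, _, _, _, ρ, .choiceR P u => .choiceR (P.ren ρ) (u.ren ρ)
  | _, _, _, _, _, ρ, .parL (a := a) (R := R) t Q =>
      (Trans.parL (t.ren ρ) (Q.ren ρ)).castT
        (congrArg (Proc.par (R.ren (a.lift ρ))) (Act.shift_ren ρ a Q))
  | _, _, _, _, _, ρ, .parR (a := a) (S := S) P u =>
      (Trans.parR (P.ren ρ) (u.ren ρ)).castT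
        (congrArg (fun P' => Proc.par P' (S.ren (a.lift ρ))) (Act.shift_ren ρ a P))
  | _, _, _, _, _, ρ, .tauL (R := R) (S := S) (y := y) t u =>
      (Trans.tauL (t.ren ρ) (u.ren ρ)).castC rfl
        (congrArg (fun R' => Proc.par R' (S.ren ρ)) (Proc.ren_pop ρ y R))
  | _, _, _, _, _, ρ, .tauR (R := R) (S := S) (y := y) t u =>
      (Trans.tauR (t.ren ρ) (u.ren ρ)).castC rfl
        (congrArg (Proc.par (R.ren ρ)) (Proc.ren_pop ρ y S))
  | _, _, _, _, _, ρ, .extrude t => .extrude (t.ren (PiCalc.lift ρ))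
  | _, _, _, _, _, ρ, .nuL t u => .nuL (t.ren ρ) (u.ren ρ)
  | _, _, _, _, _, ρ, .nuR t u => .nuR (t.ren ρ) (u.ren ρ)
  | _, _, _, _, _, ρ, .nu (.bd b) t =>
      (Trans.nu (.bd (b.ren ρ))
        ((t.ren (PiCalc.lift ρ)).castB (b' := (b.ren ρ).ren push)
          (by rw [BAct.ren_ren, BAct.ren_ren, push_comm]) rfl)).castB rfl
        (congrArg Proc.nu (Proc.ren_swap ρ _))
  | _, _, _, _, _, ρ, .nu (.nb c) t =>
      Trans.nu (.nb (c.ren ρ))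
        ((t.ren (PiCalc.lift ρ)).castC (c' := (c.ren ρ).ren push)
          (by rw [CAct.ren_ren, CAct.ren_ren, push_comm]) rfl)
  | _, _, _, _, _, ρ, .rep t => .rep (t.ren ρ)

/-! ## Concurrent actions and their residuals -/

/-- Concurrent actions `a ⌣ a'`: `cc`, `bc` (with its mirror image `cb`) and `bb` are the general
cases; `ext` is the case of two extrusions of the same binder; `nn` is the case of two
`ν`-synchronisations of distinct binders. -/
inductive ActConcur {Γ : ℕ} : Act Γ → Act Γ → Type
  | cc (c c' : CAct Γ) : ActConcur (.nb c) (.nb c')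
  | bc (b : BAct Γ) (c : CAct Γ) : ActConcur (.bd b) (.nb c)
  | cb (c : CAct Γ) (b : BAct Γ) : ActConcur (.nb c) (.bd b)
  | bb (b b' : BAct Γ) : ActConcur (.bd b) (.bd b')
  | ext (x y : Fin Γ) : ActConcur (.bd (.bout x)) (.bd (.bout y))
  | nn : ActConcur (.nb .tau) (.nb .tau)

namespace ActConcur

/-- The residual action `a'/a`. -/
def res' {Γ : ℕ} {a a' : Act Γ} : ActConcur a a' → Act (Γ + a.size)
  | cc _ c' => .nb c'
  | bc _ c => .nb (c.ren push)
  | cb _ b => .bd b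
  | bb _ b' => .bd (b'.ren push)
  | ext _ y => .nb (.out y.succ (0 : Fin (Γ + 1)))
  | nn => .nb .tau

/-- The residual action `a/a'`. -/
def res {Γ : ℕ} {a a' : Act Γ} : ActConcur a a' → Act (Γ + a'.size)
  | cc c _ => .nb c
  | bc b _ => .bd b
  | cb c _ => .nb (c.ren push)
  | bb b _ => .bd (b.ren push)
  | ext x _ => .nb (.out x.succ (0 : Fin (Γ + 1)))
  | nn => .nb .tau

def symm {Γ : ℕ} {a a' : Act Γ} : ActConcur a a' → ActConcur a' a
  | cc c c' => cc c' c
  | bc b c => cb c b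
  | cb c b => bc b c
  | bb b b' => bb b' b
  | ext x y => ext y x
  | nn => nn

/-- Concurrent actions are closed under renaming. -/
def ren {Γ Δ : ℕ} (ρ : Fin Γ → Fin Δ) {a a' : Act Γ} :
    ActConcur a a' → ActConcur (a.ren ρ) (a'.ren ρ)
  | cc c c' => cc (c.ren ρ) (c'.ren ρ)
  | bc b c => bc (b.ren ρ) (c.ren ρ)
  | cb c b => cb (c.ren ρ) (b.ren ρ)
  | bb b b' => bb (b.ren ρ) (b'.ren ρ)
  | ext x y => ext (ρ x) (ρ y)
  | nn => nn

/-- The general case for two given actions: neither the extrusion of a common binder nor a pair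
of `ν`-synchronisations. -/
def general {Γ : ℕ} : (a a' : Act Γ) → ActConcur a a'
  | .nb c, .nb c' => cc c c'
  | .bd b, .nb c => bc b c
  | .nb c, .bd b => cb c b
  | .bd b, .bd b' => bb b b'

end ActConcur

/-! ## Concurrent transitions -/

/-- `Concur k t t'`: proofs of `t ⌣ t'` with concurrent actions `k : a ⌣ a'`. -/
inductive Concur : {Γ : ℕ} → {P : Proc Γ} → {a a' : Act Γ} → {R : Proc (Γ + a.size)} →
    {R' : Proc (Γ + a'.size)} → ActConcur a a' → Trans P a R → Trans P a' R' → Type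
  | symm {Γ : ℕ} {P : Proc Γ} {a a' : Act Γ} {R : Proc (Γ + a.size)} {R' : Proc (Γ + a'.size)}
      {k : ActConcur a a'} {t : Trans P a R} {t' : Trans P a' R'} (h : Concur k t t') :
      Concur k.symm t' t
  -- opposite sides of a parallel composition
  | parRL {Γ : ℕ} {P Q : Proc Γ} {a a' : Act Γ} {R : Proc (Γ + a'.size)} {S : Proc (Γ + a.size)}
      (t : Trans P a' R) (u : Trans Q a S) :
      Concur (.general a a') (.parR P u) (.parL t Q)
  -- propagation on one side against a synchronisation
  | parL_tauL_b {Γ : ℕ} {P Q : Proc Γ} {b : BAct Γ} {x y : Fin Γ} {R R' : Proc (Γ + 1)}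
      {S : Proc Γ} {t : Trans P (.bd b) R} {t' : Trans P (.bd (.inp x)) R'}
      (h : Concur (.bb b (.inp x)) t t') (u : Trans Q (.nb (.out x y)) S) :
      Concur (.bc b .tau) (.parL t Q) (.tauL t' u)
  | parL_tauL_c {Γ : ℕ} {P Q : Proc Γ} {c : CAct Γ} {x y : Fin Γ} {R : Proc Γ}
      {R' : Proc (Γ + 1)} {S : Proc Γ} {t : Trans P (.nb c) R} {t' : Trans P (.bd (.inp x)) R'}
      (h : Concur (.cb c (.inp x)) t t') (u : Trans Q (.nb (.out x y)) S) :
      Concur (.cc c .tau) (.parL t Q) (.tauL t' u)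
  | parL_tauR_b {Γ : ℕ} {P Q : Proc Γ} {b : BAct Γ} {x y : Fin Γ} {R : Proc (Γ + 1)}
      {R' : Proc Γ} {S : Proc (Γ + 1)} {t : Trans P (.bd b) R} {t' : Trans P (.nb (.out x y)) R'}
      (h : Concur (.bc b (.out x y)) t t') (u : Trans Q (.bd (.inp x)) S) :
      Concur (.bc b .tau) (.parL t Q) (.tauR t' u)
  | parL_tauR_c {Γ : ℕ} {P Q : Proc Γ} {c : CAct Γ} {x y : Fin Γ} {R : Proc Γ}
      {R' : Proc Γ} {S : Proc (Γ + 1)} {t : Trans P (.nb c) R} {t' : Trans P (.nb (.out x y)) R'}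
      (h : Concur (.cc c (.out x y)) t t') (u : Trans Q (.bd (.inp x)) S) :
      Concur (.cc c .tau) (.parL t Q) (.tauR t' u)
  | parR_tauL_b {Γ : ℕ} {P Q : Proc Γ} {b : BAct Γ} {x y : Fin Γ} {R : Proc (Γ + 1)}
      {S : Proc (Γ + 1)} {S' : Proc Γ} {u : Trans Q (.bd b) S} {u' : Trans Q (.nb (.out x y)) S'}
      (t : Trans P (.bd (.inp x)) R) (h : Concur (.bc b (.out x y)) u u') :
      Concur (.bc b .tau) (.parR P u) (.tauL t u')
  | parR_tauL_c {Γ : ℕ} {P Q : Proc Γ} {c : CAct Γ} {x y : Fin Γ} {R : Proc (Γ + 1)}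
      {S : Proc Γ} {S' : Proc Γ} {u : Trans Q (.nb c) S} {u' : Trans Q (.nb (.out x y)) S'}
      (t : Trans P (.bd (.inp x)) R) (h : Concur (.cc c (.out x y)) u u') :
      Concur (.cc c .tau) (.parR P u) (.tauL t u')
  | parR_tauR_b {Γ : ℕ} {P Q : Proc Γ} {b : BAct Γ} {x y : Fin Γ} {R : Proc Γ}
      {S S' : Proc (Γ + 1)} {u : Trans Q (.bd b) S} {u' : Trans Q (.bd (.inp x)) S'}
      (t : Trans P (.nb (.out x y)) R) (h : Concur (.bb b (.inp x)) u u') :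
      Concur (.bc b .tau) (.parR P u) (.tauR t u')
  | parR_tauR_c {Γ : ℕ} {P Q : Proc Γ} {c : CAct Γ} {x y : Fin Γ} {R : Proc Γ}
      {S : Proc Γ} {S' : Proc (Γ + 1)} {u : Trans Q (.nb c) S} {u' : Trans Q (.bd (.inp x)) S'}
      (t : Trans P (.nb (.out x y)) R) (h : Concur (.cb c (.inp x)) u u') :
      Concur (.cc c .tau) (.parR P u) (.tauR t u')
  -- propagation on one side against a `ν`-synchronisation
  | parL_nuL_b {Γ : ℕ} {P Q : Proc Γ} {b : BAct Γ} {x : Fin Γ} {R R' S : Proc (Γ + 1)}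
      {t : Trans P (.bd b) R} {t' : Trans P (.bd (.inp x)) R'}
      (h : Concur (.bb b (.inp x)) t t') (u : Trans Q (.bd (.bout x)) S) :
      Concur (.bc b .tau) (.parL t Q) (.nuL t' u)
  | parL_nuL_c {Γ : ℕ} {P Q : Proc Γ} {c : CAct Γ} {x : Fin Γ} {R : Proc Γ}
      {R' S : Proc (Γ + 1)} {t : Trans P (.nb c) R} {t' : Trans P (.bd (.inp x)) R'}
      (h : Concur (.cb c (.inp x)) t t') (u : Trans Q (.bd (.bout x)) S) :
      Concur (.cc c .tau) (.parL t Q) (.nuL t' u)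
  | parL_nuR_b {Γ : ℕ} {P Q : Proc Γ} {b : BAct Γ} {x : Fin Γ} {R R' S : Proc (Γ + 1)}
      {t : Trans P (.bd b) R} {t' : Trans P (.bd (.bout x)) R'}
      (h : Concur (.bb b (.bout x)) t t') (u : Trans Q (.bd (.inp x)) S) :
      Concur (.bc b .tau) (.parL t Q) (.nuR t' u)
  | parL_nuR_ext {Γ : ℕ} {P Q : Proc Γ} {x' x : Fin Γ} {R R' S : Proc (Γ + 1)}
      {t : Trans P (.bd (.bout x')) R} {t' : Trans P (.bd (.bout x)) R'}
      (h : Concur (.ext x' x) t t') (u : Trans Q (.bd (.inp x)) S) :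
      Concur (.bc (.bout x') .tau) (.parL t Q) (.nuR t' u)
  | parL_nuR_c {Γ : ℕ} {P Q : Proc Γ} {c : CAct Γ} {x : Fin Γ} {R : Proc Γ}
      {R' S : Proc (Γ + 1)} {t : Trans P (.nb c) R} {t' : Trans P (.bd (.bout x)) R'}
      (h : Concur (.cb c (.bout x)) t t') (u : Trans Q (.bd (.inp x)) S) :
      Concur (.cc c .tau) (.parL t Q) (.nuR t' u)
  | parR_nuL_b {Γ : ℕ} {P Q : Proc Γ} {b : BAct Γ} {x : Fin Γ} {R S S' : Proc (Γ + 1)}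
      {u : Trans Q (.bd b) S} {u' : Trans Q (.bd (.bout x)) S'}
      (t : Trans P (.bd (.inp x)) R) (h : Concur (.bb b (.bout x)) u u') :
      Concur (.bc b .tau) (.parR P u) (.nuL t u')
  | parR_nuL_ext {Γ : ℕ} {P Q : Proc Γ} {x' x : Fin Γ} {R S S' : Proc (Γ + 1)}
      {u : Trans Q (.bd (.bout x')) S} {u' : Trans Q (.bd (.bout x)) S'}
      (t : Trans P (.bd (.inp x)) R) (h : Concur (.ext x' x) u u') :
      Concur (.bc (.bout x') .tau) (.parR P u) (.nuL t u')
  | parR_nuL_c {Γ : ℕ} {P Q : Proc Γ} {c : CAct Γ} {x : Fin Γ} {R : Proc (Γ + 1)}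
      {S : Proc Γ} {S' : Proc (Γ + 1)} {u : Trans Q (.nb c) S} {u' : Trans Q (.bd (.bout x)) S'}
      (t : Trans P (.bd (.inp x)) R) (h : Concur (.cb c (.bout x)) u u') :
      Concur (.cc c .tau) (.parR P u) (.nuL t u')
  | parR_nuR_b {Γ : ℕ} {P Q : Proc Γ} {b : BAct Γ} {x : Fin Γ} {R S S' : Proc (Γ + 1)}
      {u : Trans Q (.bd b) S} {u' : Trans Q (.bd (.inp x)) S'}
      (t : Trans P (.bd (.bout x)) R) (h : Concur (.bb b (.inp x)) u u') :
      Concur (.bc b .tau) (.parR P u) (.nuR t u')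
  | parR_nuR_c {Γ : ℕ} {P Q : Proc Γ} {c : CAct Γ} {x : Fin Γ} {R : Proc (Γ + 1)}
      {S : Proc Γ} {S' : Proc (Γ + 1)} {u : Trans Q (.nb c) S} {u' : Trans Q (.bd (.inp x)) S'}
      (t : Trans P (.bd (.bout x)) R) (h : Concur (.cb c (.inp x)) u u') :
      Concur (.cc c .tau) (.parR P u) (.nuR t u')
  -- choice; propagation on the same side
  | choiceL {Γ : ℕ} {P : Proc Γ} {a a' : Act Γ} {R : Proc (Γ + a.size)} {R' : Proc (Γ + a'.size)}
      {k : ActConcur a a'} {t : Trans P a R} {t' : Trans P a' R'} (h : Concur k t t')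
      (Q : Proc Γ) : Concur k (.choiceL t Q) (.choiceL t' Q)
  | choiceR {Γ : ℕ} {Q : Proc Γ} {a a' : Act Γ} {S : Proc (Γ + a.size)} {S' : Proc (Γ + a'.size)}
      {k : ActConcur a a'} {u : Trans Q a S} {u' : Trans Q a' S'} (P : Proc Γ)
      (h : Concur k u u') : Concur k (.choiceR P u) (.choiceR P u')
  | parLL {Γ : ℕ} {P : Proc Γ} {a a' : Act Γ} {R : Proc (Γ + a.size)} {R' : Proc (Γ + a'.size)}
      {k : ActConcur a a'} {t : Trans P a R} {t' : Trans P a' R'} (h : Concur k t t')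
      (Q : Proc Γ) : Concur k (.parL t Q) (.parL t' Q)
  | parRR {Γ : ℕ} {Q : Proc Γ} {a a' : Act Γ} {S : Proc (Γ + a.size)} {S' : Proc (Γ + a'.size)}
      {k : ActConcur a a'} {u : Trans Q a S} {u' : Trans Q a' S'} (P : Proc Γ)
      (h : Concur k u u') : Concur k (.parR P u) (.parR P u')
  -- two synchronisations
  | tauL_tauL {Γ : ℕ} {P Q : Proc Γ} {x y x' y' : Fin Γ} {R R' : Proc (Γ + 1)} {S S' : Proc Γ}
      {t : Trans P (.bd (.inp x)) R} {t' : Trans P (.bd (.inp x')) R'}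
      {u : Trans Q (.nb (.out x y)) S} {u' : Trans Q (.nb (.out x' y')) S'}
      (h : Concur (.bb (.inp x) (.inp x')) t t') (g : Concur (.cc (.out x y) (.out x' y')) u u') :
      Concur (.cc .tau .tau) (.tauL t u) (.tauL t' u')
  | tauR_tauR {Γ : ℕ} {P Q : Proc Γ} {x y x' y' : Fin Γ} {R R' : Proc Γ} {S S' : Proc (Γ + 1)}
      {t : Trans P (.nb (.out x y)) R} {t' : Trans P (.nb (.out x' y')) R'}
      {u : Trans Q (.bd (.inp x)) S} {u' : Trans Q (.bd (.inp x')) S'}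
      (h : Concur (.cc (.out x y) (.out x' y')) t t') (g : Concur (.bb (.inp x) (.inp x')) u u') :
      Concur (.cc .tau .tau) (.tauR t u) (.tauR t' u')
  | tauL_tauR {Γ : ℕ} {P Q : Proc Γ} {x y x' y' : Fin Γ} {R : Proc (Γ + 1)} {R' : Proc Γ}
      {S : Proc Γ} {S' : Proc (Γ + 1)}
      {t : Trans P (.bd (.inp x)) R} {t' : Trans P (.nb (.out x' y')) R'}
      {u : Trans Q (.nb (.out x y)) S} {u' : Trans Q (.bd (.inp x')) S'}
      (h : Concur (.bc (.inp x) (.out x' y')) t t') (g : Concur (.cb (.out x y) (.inp x')) u u') :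
      Concur (.cc .tau .tau) (.tauL t u) (.tauR t' u')
  -- a synchronisation and a `ν`-synchronisation
  | tauL_nuL {Γ : ℕ} {P Q : Proc Γ} {x y x' : Fin Γ} {R R' : Proc (Γ + 1)} {S : Proc Γ}
      {S' : Proc (Γ + 1)} {t : Trans P (.bd (.inp x)) R} {t' : Trans P (.bd (.inp x')) R'}
      {u : Trans Q (.nb (.out x y)) S} {u' : Trans Q (.bd (.bout x')) S'}
      (h : Concur (.bb (.inp x) (.inp x')) t t') (g : Concur (.cb (.out x y) (.bout x')) u u') :
      Concur (.cc .tau .tau) (.tauL t u) (.nuL t' u')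
  | tauR_nuL {Γ : ℕ} {P Q : Proc Γ} {x y x' : Fin Γ} {R : Proc Γ} {R' S S' : Proc (Γ + 1)}
      {t : Trans P (.nb (.out x y)) R} {t' : Trans P (.bd (.inp x')) R'}
      {u : Trans Q (.bd (.inp x)) S} {u' : Trans Q (.bd (.bout x')) S'}
      (h : Concur (.cb (.out x y) (.inp x')) t t') (g : Concur (.bb (.inp x) (.bout x')) u u') :
      Concur (.cc .tau .tau) (.tauR t u) (.nuL t' u')
  | tauL_nuR {Γ : ℕ} {P Q : Proc Γ} {x y x' : Fin Γ} {R R' : Proc (Γ + 1)} {S : Proc Γ}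
      {S' : Proc (Γ + 1)} {t : Trans P (.bd (.inp x)) R} {t' : Trans P (.bd (.bout x')) R'}
      {u : Trans Q (.nb (.out x y)) S} {u' : Trans Q (.bd (.inp x')) S'}
      (h : Concur (.bb (.inp x) (.bout x')) t t') (g : Concur (.cb (.out x y) (.inp x')) u u') :
      Concur (.cc .tau .tau) (.tauL t u) (.nuR t' u')
  | tauR_nuR {Γ : ℕ} {P Q : Proc Γ} {x y x' : Fin Γ} {R : Proc Γ} {R' S S' : Proc (Γ + 1)}
      {t : Trans P (.nb (.out x y)) R} {t' : Trans P (.bd (.bout x')) R'}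
      {u : Trans Q (.bd (.inp x)) S} {u' : Trans Q (.bd (.inp x')) S'}
      (h : Concur (.cb (.out x y) (.bout x')) t t') (g : Concur (.bb (.inp x) (.inp x')) u u') :
      Concur (.cc .tau .tau) (.tauR t u) (.nuR t' u')
  -- two `ν`-synchronisations: of distinct binders, or of the same binder (`_ext`)
  | nuL_nuL {Γ : ℕ} {P Q : Proc Γ} {x x' : Fin Γ} {R R' S S' : Proc (Γ + 1)}
      {t : Trans P (.bd (.inp x)) R} {t' : Trans P (.bd (.inp x')) R'}
      {u : Trans Q (.bd (.bout x)) S} {u' : Trans Q (.bd (.bout x')) S'}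
      (h : Concur (.bb (.inp x) (.inp x')) t t') (g : Concur (.bb (.bout x) (.bout x')) u u') :
      Concur .nn (.nuL t u) (.nuL t' u')
  | nuL_nuL_ext {Γ : ℕ} {P Q : Proc Γ} {x x' : Fin Γ} {R R' S S' : Proc (Γ + 1)}
      {t : Trans P (.bd (.inp x)) R} {t' : Trans P (.bd (.inp x')) R'}
      {u : Trans Q (.bd (.bout x)) S} {u' : Trans Q (.bd (.bout x')) S'}
      (h : Concur (.bb (.inp x) (.inp x')) t t') (g : Concur (.ext x x') u u') :
      Concur (.cc .tau .tau) (.nuL t u) (.nuL t' u')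
  | nuR_nuR {Γ : ℕ} {P Q : Proc Γ} {x x' : Fin Γ} {R R' S S' : Proc (Γ + 1)}
      {t : Trans P (.bd (.bout x)) R} {t' : Trans P (.bd (.bout x')) R'}
      {u : Trans Q (.bd (.inp x)) S} {u' : Trans Q (.bd (.inp x')) S'}
      (h : Concur (.bb (.bout x) (.bout x')) t t') (g : Concur (.bb (.inp x) (.inp x')) u u') :
      Concur .nn (.nuR t u) (.nuR t' u')
  | nuR_nuR_ext {Γ : ℕ} {P Q : Proc Γ} {x x' : Fin Γ} {R R' S S' : Proc (Γ + 1)}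
      {t : Trans P (.bd (.bout x)) R} {t' : Trans P (.bd (.bout x')) R'}
      {u : Trans Q (.bd (.inp x)) S} {u' : Trans Q (.bd (.inp x')) S'}
      (h : Concur (.ext x x') t t') (g : Concur (.bb (.inp x) (.inp x')) u u') :
      Concur (.cc .tau .tau) (.nuR t u) (.nuR t' u')
  | nuL_nuR {Γ : ℕ} {P Q : Proc Γ} {x x' : Fin Γ} {R R' S S' : Proc (Γ + 1)}
      {t : Trans P (.bd (.inp x)) R} {t' : Trans P (.bd (.bout x')) R'}
      {u : Trans Q (.bd (.bout x)) S} {u' : Trans Q (.bd (.inp x')) S'}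
      (h : Concur (.bb (.inp x) (.bout x')) t t') (g : Concur (.bb (.bout x) (.inp x')) u u') :
      Concur .nn (.nuL t u) (.nuR t' u')
  -- restriction and replication
  | extrude_extrude {Γ : ℕ} {P : Proc (Γ + 1)} {x x' : Fin Γ} {R R' : Proc (Γ + 1)}
      {t : Trans P (.nb (.out x.succ 0)) R} {t' : Trans P (.nb (.out x'.succ 0)) R'}
      (h : Concur (.cc (.out x.succ 0) (.out x'.succ 0)) t t') :
      Concur (.ext x x') (.extrude t) (.extrude t')
  | extrude_nu_b {Γ : ℕ} {P : Proc (Γ + 1)} {x : Fin Γ} {b : BAct Γ} {R : Proc (Γ + 1)}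
      {R' : Proc (Γ + 2)} {t : Trans P (.nb (.out x.succ 0)) R} {t' : Trans P (.bd (b.ren push)) R'}
      (h : Concur (.cb (.out x.succ 0) (b.ren push)) t t') :
      Concur (.bb (.bout x) b) (.extrude t) (.nu (.bd b) t')
  | extrude_nu_c {Γ : ℕ} {P : Proc (Γ + 1)} {x : Fin Γ} {c : CAct Γ} {R R' : Proc (Γ + 1)}
      {t : Trans P (.nb (.out x.succ 0)) R} {t' : Trans P (.nb (c.ren push)) R'}
      (h : Concur (.cc (.out x.succ 0) (c.ren push)) t t') :
      Concur (.bc (.bout x) c) (.extrude t) (.nu (.nb c) t')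
  | nu_nu {Γ : ℕ} {P : Proc (Γ + 1)} {a a' : Act Γ} {R : Proc (Γ + 1 + (a.ren push).size)}
      {R' : Proc (Γ + 1 + (a'.ren push).size)} {k : ActConcur a a'}
      {t : Trans P (a.ren push) R} {t' : Trans P (a'.ren push) R'}
      (h : Concur (k.ren push) t t') : Concur k (.nu a t) (.nu a' t')
  | rep {Γ : ℕ} {P : Proc Γ} {a a' : Act Γ} {R : Proc (Γ + a.size)} {R' : Proc (Γ + a'.size)}
      {k : ActConcur a a'} {t : Trans (.par P (.rep P)) a R} {t' : Trans (.par P (.rep P)) a' R'}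
      (h : Concur k t t') : Concur k (.rep t) (.rep t')

/-! ## Residuals of concurrent transitions -/

/-- A pair of transitions from `R` and `R'` with the residual actions `a'/a` and `a/a'`. -/
structure Residuals {Γ : ℕ} {a a' : Act Γ} (k : ActConcur a a')
    (R : Proc (Γ + a.size)) (R' : Proc (Γ + a'.size)) : Type where
  /-- target of `t'/t` -/
  tgt' : Proc (Γ + a.size + k.res'.size)
  /-- target of `t/t'` -/
  tgt : Proc (Γ + a'.size + k.res.size)
  /-- `t'/t` -/
  after' : Trans R k.res' tgt'
  /-- `t/t'` -/
  after : Trans R' k.res tgt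

namespace Residuals

def symm {Γ : ℕ} {a a' : Act Γ} : {k : ActConcur a a'} → {R : Proc (Γ + a.size)} →
    {R' : Proc (Γ + a'.size)} → Residuals k R R' → Residuals k.symm R' R
  | .cc _ _, _, _, ⟨_, _, v', v⟩ => ⟨_, _, v, v'⟩
  | .bc _ _, _, _, ⟨_, _, v', v⟩ => ⟨_, _, v, v'⟩
  | .cb _ _, _, _, ⟨_, _, v', v⟩ => ⟨_, _, v, v'⟩
  | .bb _ _, _, _, ⟨_, _, v', v⟩ => ⟨_, _, v, v'⟩
  | .ext _ _, _, _, ⟨_, _, v', v⟩ => ⟨_, _, v, v'⟩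
  | .nn, _, _, ⟨_, _, v', v⟩ => ⟨_, _, v, v'⟩

/-- The residuals of `P | u` and `t | Q`. -/
def parRL {Γ : ℕ} {P Q : Proc Γ} : {a a' : Act Γ} → {R : Proc (Γ + a'.size)} →
    {S : Proc (Γ + a.size)} → Trans P a' R → Trans Q a S →
    Residuals (.general a a') (.par (a.shift P) S) (.par R (a'.shift Q))
  | .nb _, .nb _, R, S, t, u => ⟨_, _, .parL t S, .parR R u⟩
  | .bd _, .nb _, R, S, t, u => ⟨_, _, .parL (t.ren push) S, .parR R u⟩
  | .nb _, .bd _, R, S, t, u => ⟨_, _, .parL t S, .parR R (u.ren push)⟩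
  | .bd _, .bd _, R, S, t, u => ⟨_, _, .parL (t.ren push) S, .parR R (u.ren push)⟩

/-- The residuals of `t | Q` and `t' | Q`. -/
def parL {Γ : ℕ} {a a' : Act Γ} : {k : ActConcur a a'} → {R : Proc (Γ + a.size)} →
    {R' : Proc (Γ + a'.size)} → Residuals k R R' → (Q : Proc Γ) →
    Residuals k (.par R (a.shift Q)) (.par R' (a'.shift Q))
  | .cc _ _, _, _, ⟨_, _, v', v⟩, Q => ⟨_, _, .parL v' Q, .parL v Q⟩
  | .bc _ _, _, _, ⟨_, _, v', v⟩, Q => ⟨_, _, .parL v' (Q.ren push), .parL v Q⟩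
  | .cb _ _, _, _, ⟨_, _, v', v⟩, Q => ⟨_, _, .parL v' Q, .parL v (Q.ren push)⟩
  | .bb _ _, _, _, ⟨_, _, v', v⟩, Q => ⟨_, _, .parL v' (Q.ren push), .parL v (Q.ren push)⟩
  | .ext _ _, _, _, ⟨_, _, v', v⟩, Q => ⟨_, _, .parL v' (Q.ren push), .parL v (Q.ren push)⟩
  | .nn, _, _, ⟨_, _, v', v⟩, Q => ⟨_, _, .parL v' Q, .parL v Q⟩

/-- The residuals of `P | u` and `P | u'`. -/
def parR {Γ : ℕ} {a a' : Act Γ} (P : Proc Γ) : {k : ActConcur a a'} → {S : Proc (Γ + a.size)} →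
    {S' : Proc (Γ + a'.size)} → Residuals k S S' →
    Residuals k (.par (a.shift P) S) (.par (a'.shift P) S')
  | .cc _ _, _, _, ⟨_, _, v', v⟩ => ⟨_, _, .parR P v', .parR P v⟩
  | .bc _ _, _, _, ⟨_, _, v', v⟩ => ⟨_, _, .parR (P.ren push) v', .parR P v⟩
  | .cb _ _, _, _, ⟨_, _, v', v⟩ => ⟨_, _, .parR P v', .parR (P.ren push) v⟩
  | .bb _ _, _, _, ⟨_, _, v', v⟩ => ⟨_, _, .parR (P.ren push) v', .parR (P.ren push) v⟩
  | .ext _ _, _, _, ⟨_, _, v', v⟩ => ⟨_, _, .parR (P.ren push) v', .parR (P.ren push) v⟩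
  | .nn, _, _, ⟨_, _, v', v⟩ => ⟨_, _, .parR P v', .parR P v⟩

/-- The residuals of `ν t` and `ν t'`. -/
def nu {Γ : ℕ} {a a' : Act Γ} : {k : ActConcur a a'} → {R : Proc (Γ + 1 + (a.ren push).size)} →
    {R' : Proc (Γ + 1 + (a'.ren push).size)} → Residuals (k.ren push) R R' →
    Residuals k (a.close R) (a'.close R')
  | .cc c c', _, _, ⟨_, _, v', v⟩ => ⟨_, _, .nu (.nb c') v', .nu (.nb c) v⟩
  | .bc b c, _, _, ⟨_, _, v', v⟩ =>
      ⟨_, _, .nu (.nb (c.ren push)) ((v'.ren swap).castC c.push_push_swap rfl), .nu (.bd b) v⟩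
  | .cb c b, _, _, ⟨_, _, v', v⟩ =>
      ⟨_, _, .nu (.bd b) v', .nu (.nb (c.ren push)) ((v.ren swap).castC c.push_push_swap rfl)⟩
  | .bb b b', _, _, ⟨_, _, v', v⟩ =>
      ⟨_, _, .nu (.bd (b'.ren push)) ((v'.ren swap).castB b'.push_push_swap rfl),
        .nu (.bd (b.ren push)) ((v.ren swap).castB b.push_push_swap rfl)⟩
  | .ext x y, _, _, ⟨_, _, v', v⟩ =>
      ⟨_, _, .nu (.nb (.out y.succ 0)) ((v'.ren swap).castC rfl rfl),
        .nu (.nb (.out x.succ 0)) ((v.ren swap).castC rfl rfl)⟩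
  | .nn, _, _, ⟨_, _, v', v⟩ => ⟨_, _, .nu (.nb .tau) v', .nu (.nb .tau) v⟩

end Residuals

/-- The residuals `t'/t` and `t/t'` of concurrent transitions `t ⌣ t'`. -/
def Concur.residuals : {Γ : ℕ} → {P : Proc Γ} → {a a' : Act Γ} → {R : Proc (Γ + a.size)} →
    {R' : Proc (Γ + a'.size)} → {k : ActConcur a a'} → {t : Trans P a R} → {t' : Trans P a' R'} →
    Concur k t t' → Residuals k R R'
  | _, _, _, _, _, _, _, _, _, .symm h => h.residuals.symm
  | _, _, _, _, _, _, _, _, _, .parRL t u => .parRL t u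
  | _, _, _, _, _, _, _, _, _, .parL_tauL_b (b := b) (y := y) (S := S) h u =>
      ⟨_, _, .tauL h.residuals.after' (u.ren push),
        .parL ((h.residuals.after.ren (pop y)).castB (b.push_pop y) rfl) S⟩
  | _, _, _, _, _, _, _, _, _, .parL_tauL_c (c := c) (y := y) (S := S) h u =>
      ⟨_, _, .tauL h.residuals.after' u,
        .parL ((h.residuals.after.ren (pop y)).castC (c.push_pop y) rfl) S⟩
  | _, _, _, _, _, _, _, _, _, .parL_tauR_b (y := y) (S := S) h u =>
      ⟨_, _, .tauR h.residuals.after' (u.ren push), .parL h.residuals.after (S.ren (pop y))⟩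
  | _, _, _, _, _, _, _, _, _, .parL_tauR_c (y := y) (S := S) h u =>
      ⟨_, _, .tauR h.residuals.after' u, .parL h.residuals.after (S.ren (pop y))⟩
  | _, _, _, _, _, _, _, _, _, .parR_tauL_b (y := y) (R := R) t h =>
      ⟨_, _, .tauL (t.ren push) h.residuals.after', .parR (R.ren (pop y)) h.residuals.after⟩
  | _, _, _, _, _, _, _, _, _, .parR_tauL_c (y := y) (R := R) t h =>
      ⟨_, _, .tauL t h.residuals.after', .parR (R.ren (pop y)) h.residuals.after⟩
  | _, _, _, _, _, _, _, _, _, .parR_tauR_b (b := b) (y := y) (R := R) t h =>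
      ⟨_, _, .tauR (t.ren push) h.residuals.after',
        .parR R ((h.residuals.after.ren (pop y)).castB (b.push_pop y) rfl)⟩
  | _, _, _, _, _, _, _, _, _, .parR_tauR_c (c := c) (y := y) (R := R) t h =>
      ⟨_, _, .tauR t h.residuals.after',
        .parR R ((h.residuals.after.ren (pop y)).castC (c.push_pop y) rfl)⟩
  | _, _, _, _, _, _, _, _, _, .parL_nuL_b (b := b) (S := S) h u =>
      ⟨_, _, .nuL h.residuals.after' (u.ren push), .nu (.bd b) (.parL h.residuals.after S)⟩
  | _, _, _, _, _, _, _, _, _, .parL_nuL_c (c := c) (S := S) h u =>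
      ⟨_, _, .nuL h.residuals.after' u, .nu (.nb c) (.parL h.residuals.after S)⟩
  | _, _, _, _, _, _, _, _, _, .parL_nuR_b (b := b) (S := S) h u =>
      ⟨_, _, .nuR h.residuals.after' (u.ren push), .nu (.bd b) (.parL h.residuals.after S)⟩
  | _, _, _, _, _, _, _, _, _, .parL_nuR_ext (S := S) h u =>
      ⟨_, _, .tauR h.residuals.after' (u.ren push), .extrude (.parL h.residuals.after S)⟩
  | _, _, _, _, _, _, _, _, _, .parL_nuR_c (c := c) (S := S) h u =>
      ⟨_, _, .nuR h.residuals.after' u, .nu (.nb c) (.parL h.residuals.after S)⟩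
  | _, _, _, _, _, _, _, _, _, .parR_nuL_b (b := b) (R := R) t h =>
      ⟨_, _, .nuL (t.ren push) h.residuals.after', .nu (.bd b) (.parR R h.residuals.after)⟩
  | _, _, _, _, _, _, _, _, _, .parR_nuL_ext (R := R) t h =>
      ⟨_, _, .tauL (t.ren push) h.residuals.after', .extrude (.parR R h.residuals.after)⟩
  | _, _, _, _, _, _, _, _, _, .parR_nuL_c (c := c) (R := R) t h =>
      ⟨_, _, .nuL t h.residuals.after', .nu (.nb c) (.parR R h.residuals.after)⟩
  | _, _, _, _, _, _, _, _, _, .parR_nuR_b (b := b) (R := R) t h =>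
      ⟨_, _, .nuR (t.ren push) h.residuals.after', .nu (.bd b) (.parR R h.residuals.after)⟩
  | _, _, _, _, _, _, _, _, _, .parR_nuR_c (c := c) (R := R) t h =>
      ⟨_, _, .nuR t h.residuals.after', .nu (.nb c) (.parR R h.residuals.after)⟩
  | _, _, _, _, _, _, _, _, _, .choiceL h _ => ⟨_, _, h.residuals.after', h.residuals.after⟩
  | _, _, _, _, _, _, _, _, _, .choiceR _ h => ⟨_, _, h.residuals.after', h.residuals.after⟩
  | _, _, _, _, _, _, _, _, _, .parLL h Q => h.residuals.parL Q
  | _, _, _, _, _, _, _, _, _, .parRR P h => h.residuals.parR P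
  | _, _, _, _, _, _, _, _, _, .tauL_tauL (y := y) (y' := y') h g =>
      ⟨_, _,
        .tauL ((h.residuals.after'.ren (pop y)).castB (BAct.push_pop _ y) rfl) g.residuals.after',
        .tauL ((h.residuals.after.ren (pop y')).castB (BAct.push_pop _ y') rfl) g.residuals.after⟩
  | _, _, _, _, _, _, _, _, _, .tauR_tauR (y := y) (y' := y') h g =>
      ⟨_, _,
        .tauR h.residuals.after' ((g.residuals.after'.ren (pop y)).castB (BAct.push_pop _ y) rfl),
        .tauR h.residuals.after ((g.residuals.after.ren (pop y')).castB (BAct.push_pop _ y') rfl)⟩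
  | _, _, _, _, _, _, _, _, _, .tauL_tauR (y := y) (y' := y') h g =>
      ⟨_, _,
        .tauR ((h.residuals.after'.ren (pop y)).castC (CAct.push_pop _ y) rfl) g.residuals.after',
        .tauL h.residuals.after ((g.residuals.after.ren (pop y')).castC (CAct.push_pop _ y') rfl)⟩
  | _, _, _, _, _, _, _, _, _, .tauL_nuL (y := y) h g =>
      ⟨_, _,
        .nuL ((h.residuals.after'.ren (pop y)).castB (BAct.push_pop _ y) rfl) g.residuals.after',
        .nu (.nb .tau) (.tauL h.residuals.after g.residuals.after)⟩
  | _, _, _, _, _, _, _, _, _, .tauR_nuL (y := y) h g =>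
      ⟨_, _,
        .nuL h.residuals.after' ((g.residuals.after'.ren (pop y)).castB (BAct.push_pop _ y) rfl),
        .nu (.nb .tau) (.tauR h.residuals.after g.residuals.after)⟩
  | _, _, _, _, _, _, _, _, _, .tauL_nuR (y := y) h g =>
      ⟨_, _,
        .nuR ((h.residuals.after'.ren (pop y)).castB (BAct.push_pop _ y) rfl) g.residuals.after',
        .nu (.nb .tau) (.tauL h.residuals.after g.residuals.after)⟩
  | _, _, _, _, _, _, _, _, _, .tauR_nuR (y := y) h g =>
      ⟨_, _,
        .nuR h.residuals.after' ((g.residuals.after'.ren (pop y)).castB (BAct.push_pop _ y) rfl),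
        .nu (.nb .tau) (.tauR h.residuals.after g.residuals.after)⟩
  | _, _, _, _, _, _, _, _, _, .nuL_nuL h g =>
      ⟨_, _, .nu (.nb .tau) (.nuL h.residuals.after' g.residuals.after'),
        .nu (.nb .tau) (.nuL h.residuals.after g.residuals.after)⟩
  | _, _, _, _, _, _, _, _, _, .nuL_nuL_ext h g =>
      ⟨_, _, .nu (.nb .tau) (.tauL h.residuals.after' g.residuals.after'),
        .nu (.nb .tau) (.tauL h.residuals.after g.residuals.after)⟩
  | _, _, _, _, _, _, _, _, _, .nuR_nuR h g =>
      ⟨_, _, .nu (.nb .tau) (.nuR h.residuals.after' g.residuals.after'),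
        .nu (.nb .tau) (.nuR h.residuals.after g.residuals.after)⟩
  | _, _, _, _, _, _, _, _, _, .nuR_nuR_ext h g =>
      ⟨_, _, .nu (.nb .tau) (.tauR h.residuals.after' g.residuals.after'),
        .nu (.nb .tau) (.tauR h.residuals.after g.residuals.after)⟩
  | _, _, _, _, _, _, _, _, _, .nuL_nuR h g =>
      ⟨_, _, .nu (.nb .tau) (.nuR h.residuals.after' g.residuals.after'),
        .nu (.nb .tau) (.nuL h.residuals.after g.residuals.after)⟩
  | _, _, _, _, _, _, _, _, _, .extrude_extrude (R := R) (R' := R') h =>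
      ⟨_, _, h.residuals.after', h.residuals.after⟩
  | _, _, _, _, _, _, _, _, _, .extrude_nu_b (R := R) h =>
      ⟨_, _, h.residuals.after', .extrude ((h.residuals.after.ren swap).castC rfl rfl)⟩
  | _, _, _, _, _, _, _, _, _, .extrude_nu_c (R := R) h =>
      ⟨_, _, h.residuals.after', .extrude h.residuals.after⟩
  | _, _, _, _, _, _, _, _, _, .nu_nu h => h.residuals.nu
  | _, _, _, _, _, _, _, _, _, .rep h => ⟨_, _, h.residuals.after', h.residuals.after⟩

/-! ## Braidings -/

/-- Free braid `P ⋉ R`. -/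
def FreeBraid {Γ : ℕ} (P R : Proc (Γ + 2)) : Prop := P = R.ren swap

/-- Bound braid: the derivations of `P ⋊ R`. -/
inductive BoundBraid : {Γ : ℕ} → Proc Γ → Proc Γ → Type
  | nuSwap {Γ : ℕ} {P R : Proc (Γ + 2)} (h : FreeBraid P R) :
      BoundBraid (.nu (.nu P)) (.nu (.nu R))
  | choiceL {Γ : ℕ} {P R : Proc Γ} (φ : BoundBraid P R) (Q : Proc Γ) :
      BoundBraid (.choice P Q) (.choice R Q)
  | choiceR {Γ : ℕ} {Q S : Proc Γ} (P : Proc Γ) (φ : BoundBraid Q S) :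
      BoundBraid (.choice P Q) (.choice P S)
  | parL {Γ : ℕ} {P R : Proc Γ} (φ : BoundBraid P R) (Q : Proc Γ) :
      BoundBraid (.par P Q) (.par R Q)
  | parR {Γ : ℕ} {Q S : Proc Γ} (P : Proc Γ) (φ : BoundBraid Q S) :
      BoundBraid (.par P Q) (.par P S)
  | nu {Γ : ℕ} {P R : Proc (Γ + 1)} (φ : BoundBraid P R) : BoundBraid (.nu P) (.nu R)
  | rep {Γ : ℕ} {P R : Proc Γ} (φ : BoundBraid P R) : BoundBraid (.rep P) (.rep R)

/-- One step down the syntax tree of a process. -/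
inductive Step : Type
  | choiceL | choiceR | parL | parR | nu | rep

/-- The position of the pair of `ν`-binders transposed by a bound braid. -/
def BoundBraid.position {Γ : ℕ} {P R : Proc Γ} : BoundBraid P R → List Step
  | .nuSwap _ => []
  | .choiceL φ _ => .choiceL :: φ.position
  | .choiceR _ φ => .choiceR :: φ.position
  | .parL φ _ => .parL :: φ.position
  | .parR _ φ => .parR :: φ.position
  | .nu φ => .nu :: φ.position
  | .rep φ => .rep :: φ.position

/-- For concurrent `ν`-synchronisations of distinct binders: the position, in the targets of
the residuals, of the pair of `ν`-binders which these synchronisations put back. (Transitions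
discard choices and unfold replications, so only parallel compositions and restrictions
above the synchronisations remain.) The value is not used for the other kinds of concurrent
actions. -/
def Concur.position {Γ : ℕ} {P : Proc Γ} {a a' : Act Γ} {R : Proc (Γ + a.size)}
    {R' : Proc (Γ + a'.size)} {k : ActConcur a a'} {t : Trans P a R} {t' : Trans P a' R'} :
    Concur k t t' → List Step
  | .symm h => h.position
  | .choiceL h _ => h.position
  | .choiceR _ h => h.position
  | .parLL h _ => .parL :: h.position
  | .parRR _ h => .parR :: h.position
  | .nu_nu h => .nu :: h.position
  | .rep h => h.position
  | _ => []

/-- The type of braidings `Q ⋈ Q'` induced by concurrent actions, where `Q` and `Q'`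
are processes in the target context of these actions. -/
def Braiding {Γ : ℕ} {a a' : Act Γ} : (k : ActConcur a a') →
    Proc (Γ + a.size + k.res'.size) → Proc (Γ + a'.size + k.res.size) → Type
  | .cc _ _, Q, Q' => PLift (Q = Q')
  | .bc _ _, Q, Q' => PLift (Q = Q')
  | .cb _ _, Q, Q' => PLift (Q = Q')
  | .bb _ _, Q, Q' => PLift (FreeBraid Q Q')
  | .ext _ _, Q, Q' => PLift (Q = Q')
  | .nn, Q, Q' => BoundBraid Q Q'

/-- If the braiding is a bound braid, then it transposes the pair of `ν`-binders at position
`l`; the other kinds of braiding are unrestricted. -/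
def Braiding.At {Γ : ℕ} {a a' : Act Γ} : {k : ActConcur a a'} →
    {Q : Proc (Γ + a.size + k.res'.size)} → {Q' : Proc (Γ + a'.size + k.res.size)} →
    Braiding k Q Q' → List Step → Prop
  | .nn, _, _, φ, l => BoundBraid.position φ = l
  | .cc _ _, _, _, _, _ => True
  | .bc _ _, _, _, _, _ => True
  | .cb _ _, _, _, _, _ => True
  | .bb _ _, _, _, _, _ => True
  | .ext _ _, _, _, _, _ => True

end PiCalc

namespace PiCalc

/-! ## Identities between renamings -/

/-! Existence goes by induction on the derivation of `t ⌣ t'`. At each rule, both residual targets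
arise from the targets of the premises' residuals by parallel composition, `ν`, and renamings made
of `push`, `pop` and `swap`. Each case therefore reduces to an identity between renamings, checked
on the indices 0, 1 and the rest.

Two bound actions create two fresh indices, numbered in opposite orders along the two paths; a free
braid corrects exactly this. What becomes of the braid depends on how these indices are used.
Instantiating one with `pop` gives an equality (`FreeBraid.pop_push`, `FreeBraid.lift_pop`), and so
does instantiating both (`FreeBraid.lift_pop_pop`, `FreeBraid.pop_zero`). Closing both with `ν`, as
two `ν`-synchronisations of distinct binders do, gives the axiom of bound braids. Passing a further
`ν` preserves the free braid, by the braid relation on three strands (`FreeBraid.nu`).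

Uniqueness is immediate for equalities and free braids, which are propositions. Bound braids carry
data: several may relate the same processes, as for `νν0 | νν0` and itself. Such a braid is
determined by its position (`BoundBraid.position_injective`), so the induction carries the position
along with the braiding. -/

theorem lift_id {Γ : ℕ} : lift (id : Fin Γ → Fin Γ) = id := by
  funext i
  refine Fin.cases rfl (fun x => rfl) i

theorem Proc.ren_id {Γ : ℕ} (P : Proc Γ) : P.ren id = P := by
  induction P with
  | zero => rfl
  | inp x P ih => simp only [Proc.ren, lift_id, ih, id]
  | out x y P ih => simp only [Proc.ren, ih, id]
  | choice P Q ihP ihQ => simp only [Proc.ren, ihP, ihQ]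
  | par P Q ihP ihQ => simp only [Proc.ren, ihP, ihQ]
  | nu P ih => simp only [Proc.ren, lift_id, ih]
  | rep P ih => simp only [Proc.ren, ih]

/-- Functions on `Fin (Γ + 2)` agree if they agree on `0`, on `1` and on all `x + 2`. -/
theorem funext_fin_two {Γ : ℕ} {α : Sort*} {f g : Fin (Γ + 2) → α} (h0 : f 0 = g 0)
    (h1 : f 1 = g 1) (h : ∀ x : Fin Γ, f x.succ.succ = g x.succ.succ) : f = g := by
  funext i
  exact Fin.cases h0 (fun j => Fin.cases h1 h j) i

theorem swap_swap {Γ : ℕ} : (swap ∘ swap : Fin (Γ + 2) → Fin (Γ + 2)) = id :=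
  funext_fin_two rfl rfl fun _ => rfl

/-- `push` frees index 0 and `swap` moves the gap to index 1, which is where `push` under one binder
leaves it. -/
theorem swap_push {Γ : ℕ} : (swap ∘ push : Fin (Γ + 1) → Fin (Γ + 2)) = lift push := by
  funext i
  refine Fin.cases rfl (fun x => rfl) i

theorem pop_zero_lift_push {Γ : ℕ} :
    (pop 0 ∘ lift push : Fin (Γ + 1) → Fin (Γ + 1)) = id := by
  funext i
  refine Fin.cases rfl (fun x => rfl) i

/-- The input variable has index 0 on one path and index 1 on the other, where a later fresh name
sits below it; on both it receives the shifted `y`. -/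
theorem pop_push_swap {Γ : ℕ} (y : Fin Γ) : pop (push y) ∘ swap = lift (pop y) :=
  funext_fin_two rfl rfl fun _ => rfl

/-- `pop 0` identifies the indices 0 and 1, so their order is forgotten. -/
theorem pop_zero_swap {Γ : ℕ} : (pop 0 ∘ swap : Fin (Γ + 2) → Fin (Γ + 1)) = pop 0 :=
  funext_fin_two rfl rfl fun _ => rfl

theorem pop_lift_pop_swap {Γ : ℕ} (y y' : Fin Γ) :
    pop y' ∘ lift (pop y) ∘ swap = pop y ∘ lift (pop y') :=
  funext_fin_two rfl rfl fun _ => rfl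

/-- The braid relation for the two adjacent transpositions of the indices 0, 1, 2. -/
theorem swap_lift_swap_swap {Γ : ℕ} :
    (swap ∘ lift swap ∘ swap : Fin (Γ + 3) → Fin (Γ + 3)) = lift swap ∘ swap ∘ lift swap :=
  funext_fin_two rfl rfl fun x => Fin.cases rfl (fun _ => rfl) x

theorem Proc.swap_swap {Γ : ℕ} (P : Proc (Γ + 2)) : (P.ren swap).ren swap = P := by
  rw [Proc.ren_ren, PiCalc.swap_swap, Proc.ren_id]

theorem Proc.push_swap {Γ : ℕ} (P : Proc (Γ + 1)) :
    (P.ren push).ren swap = P.ren (lift push) := by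
  rw [Proc.ren_ren, PiCalc.swap_push]

theorem Proc.lift_push_pop_zero {Γ : ℕ} (P : Proc (Γ + 1)) :
    (P.ren (lift push)).ren (pop 0) = P := by
  rw [Proc.ren_ren, pop_zero_lift_push, Proc.ren_id]

/-! ### Free braids under parallel composition, substitution and restriction. -/

namespace FreeBraid

variable {Γ : ℕ} {P R : Proc (Γ + 2)}

theorem symm (e : FreeBraid P R) : FreeBraid R P := by
  rw [FreeBraid, e, Proc.swap_swap]

theorem par {P' R' : Proc (Γ + 2)} (e : FreeBraid P R) (e' : FreeBraid P' R') :
    FreeBraid (.par P P') (.par R R') :=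
  congrArg₂ Proc.par e e'

/-- Serves a component with its own bound index that the other component's bound action shifts:
`lift push` if the shift precedes its transition, `push` if it follows. -/
theorem lift_push_push (P : Proc (Γ + 1)) : FreeBraid (P.ren (lift push)) (P.ren push) :=
  P.push_swap.symm

/-- An idle component mentions neither fresh name, so exchanging them does nothing. -/
theorem push_push (P : Proc Γ) : FreeBraid ((P.ren push).ren push) ((P.ren push).ren push) := by
  rw [FreeBraid, Proc.push_swap, Proc.ren_ren, Proc.ren_ren, push_comm]

theorem pop_push (e : FreeBraid P R) (y : Fin Γ) :
    P.ren (pop (push y)) = R.ren (lift (pop y)) := by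
  rw [e, Proc.ren_ren, pop_push_swap]

theorem lift_pop (e : FreeBraid P R) (y : Fin Γ) :
    P.ren (lift (pop y)) = R.ren (pop (push y)) :=
  (e.symm.pop_push y).symm

theorem pop_zero (e : FreeBraid P R) : P.ren (pop 0) = R.ren (pop 0) := by
  rw [e, Proc.ren_ren, pop_zero_swap]

theorem lift_pop_pop (e : FreeBraid P R) (y y' : Fin Γ) :
    (P.ren (lift (pop y))).ren (pop y') = (R.ren (lift (pop y'))).ren (pop y) := by
  rw [Proc.ren_ren, Proc.ren_ren, ← pop_lift_pop_swap y y', e, Proc.ren_ren]; rfl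

/-- Free braids propagate through a binder. -/
theorem nu {P R : Proc (Γ + 3)} (e : FreeBraid P R) :
    FreeBraid (.nu ((P.ren (lift swap)).ren swap)) (.nu ((R.ren (lift swap)).ren swap)) := by
  -- Under `ν` the braid acts as `lift swap`. Each body already carries `swap ∘ lift swap`, from
  -- taking the residual under the binder and then closing it, so substituting the hypothesis leaves
  -- the two sides of the braid relation.
  refine congrArg Proc.nu ?_
  rw [e]
  simp only [Proc.ren_ren]
  exact congrArg (fun ρ => Proc.ren ρ R) swap_lift_swap_swap

end FreeBraid

/-! ## Bound braids -/

def BoundBraid.symm {Γ : ℕ} {P R : Proc Γ} : BoundBraid P R → BoundBraid R P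
  | .nuSwap e => .nuSwap e.symm
  | .choiceL φ Q => .choiceL φ.symm Q
  | .choiceR P φ => .choiceR P φ.symm
  | .parL φ Q => .parL φ.symm Q
  | .parR P φ => .parR P φ.symm
  | .nu φ => .nu φ.symm
  | .rep φ => .rep φ.symm

theorem BoundBraid.position_symm {Γ : ℕ} {P R : Proc Γ} (φ : BoundBraid P R) :
    φ.symm.position = φ.position := by
  induction φ with
  | nuSwap e => rfl
  | choiceL φ Q ih => exact congrArg _ ih
  | choiceR P φ ih => exact congrArg _ ih
  | parL φ Q ih => exact congrArg _ ih
  | parR P φ ih => exact congrArg _ ih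
  | nu φ ih => exact congrArg _ ih
  | rep φ ih => exact congrArg _ ih

/-- There is at most one bound braid between given processes at a given position. -/
theorem BoundBraid.position_injective {Γ : ℕ} {P R : Proc Γ} :
    Function.Injective (BoundBraid.position : BoundBraid P R → List Step) := by
  intro φ
  induction φ with
  | nuSwap e =>
    intro ψ h
    cases ψ with
    | nuSwap _ => rfl
    -- The only place where two constructors build the same process former with possibly valid
    -- premises: a double restriction may be swapped here or further inside. The empty position
    -- excludes the latter.
    | nu ψ => cases h
  | choiceL φ Q ih =>
    intro ψ h
    cases ψ with
    | choiceL ψ _ => rw [ih (List.cons.inj h).2]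
    | choiceR _ ψ => cases h
  | choiceR P φ ih =>
    intro ψ h
    cases ψ with
    | choiceL ψ _ => cases h
    | choiceR _ ψ => rw [ih (List.cons.inj h).2]
  | parL φ Q ih =>
    intro ψ h
    cases ψ with
    | parL ψ _ => rw [ih (List.cons.inj h).2]
    | parR _ ψ => cases h
  | parR P φ ih =>
    intro ψ h
    cases ψ with
    | parL ψ _ => cases h
    | parR _ ψ => rw [ih (List.cons.inj h).2]
  | nu φ ih =>
    intro ψ h
    cases ψ with
    | nuSwap _ => cases h
    | nu ψ => rw [ih (List.cons.inj h).2]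
  | rep φ ih =>
    intro ψ h
    cases ψ with
    | rep ψ => rw [ih (List.cons.inj h).2]

/-- Only kind `nn` has braidings with content, and there the position settles the matter; all other
braidings are lifted propositions. -/
theorem Braiding.At.unique {Γ : ℕ} {a a' : Act Γ} {k : ActConcur a a'}
    {Q : Proc (Γ + a.size + k.res'.size)} {Q' : Proc (Γ + a'.size + k.res.size)}
    {γ δ : Braiding k Q Q'} {l : List Step} (hγ : γ.At l) (hδ : δ.At l) : γ = δ := by
  cases k with
  | nn => exact BoundBraid.position_injective (Eq.trans hγ (Eq.symm hδ))
  | _ => exact congrArg PLift.up (proof_irrel γ.down δ.down)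

/-! ## Cofinality -/

/-- The targets of a pair of residuals are related by a braiding at position `l`. -/
def Residuals.Cofinal {Γ : ℕ} {a a' : Act Γ} {k : ActConcur a a'} {R : Proc (Γ + a.size)}
    {R' : Proc (Γ + a'.size)} (r : Residuals k R R') (l : List Step) : Prop :=
  ∃ γ : Braiding k r.tgt' r.tgt, γ.At l

/-! ### Stability of cofinality under symmetry, parallel composition and restriction. -/

namespace Residuals.Cofinal

variable {Γ : ℕ} {a a' : Act Γ}

theorem symm {k : ActConcur a a'} {R : Proc (Γ + a.size)} {R' : Proc (Γ + a'.size)}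
    {r : Residuals k R R'} {l : List Step} (h : r.Cofinal l) : r.symm.Cofinal l := by
  obtain ⟨γ, hγ⟩ := h
  cases k with
  | bb => exact ⟨⟨FreeBraid.symm γ.down⟩, trivial⟩
  | nn => exact ⟨BoundBraid.symm γ, (BoundBraid.position_symm γ).trans hγ⟩
  | _ => exact ⟨⟨γ.down.symm⟩, trivial⟩

/-- The components do not interact, so only a pair of bound actions needs work: each component is
then shifted before its move on one path and after it on the other, with the roles reversed between
the two. The kind is never `nn`, whence the arbitrary `l`. -/
theorem parRL {P Q : Proc Γ} {R : Proc (Γ + a'.size)} {S : Proc (Γ + a.size)}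
    (t : Trans P a' R) (u : Trans Q a S) (l : List Step) :
    (Residuals.parRL t u).Cofinal l := by
  cases a <;> cases a'
  case bd.bd =>
    exact ⟨⟨(FreeBraid.lift_push_push R).par (FreeBraid.lift_push_push S).symm⟩, trivial⟩
  all_goals exact ⟨⟨rfl⟩, trivial⟩

theorem parL {k : ActConcur a a'} {R : Proc (Γ + a.size)} {R' : Proc (Γ + a'.size)}
    {r : Residuals k R R'} {l : List Step} (h : r.Cofinal l) (Q : Proc Γ) :
    (r.parL Q).Cofinal (.parL :: l) := by
  obtain ⟨γ, hγ⟩ := h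
  cases k with
  | bb =>
    exact ⟨⟨FreeBraid.par γ.down (.push_push Q)⟩, trivial⟩
  | nn => exact ⟨BoundBraid.parL γ Q, congrArg _ hγ⟩
  | _ => exact ⟨⟨congrArg₂ Proc.par γ.down rfl⟩, trivial⟩

theorem parR {k : ActConcur a a'} {S : Proc (Γ + a.size)} {S' : Proc (Γ + a'.size)}
    {r : Residuals k S S'} {l : List Step} (P : Proc Γ) (h : r.Cofinal l) :
    (r.parR P).Cofinal (.parR :: l) := by
  obtain ⟨γ, hγ⟩ := h
  cases k with
  | bb =>
    exact ⟨⟨FreeBraid.par (.push_push P) γ.down⟩, trivial⟩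
  | nn => exact ⟨BoundBraid.parR P γ, congrArg _ hγ⟩
  | _ => exact ⟨⟨congrArg (Proc.par _) γ.down⟩, trivial⟩

/-- With exactly one bound step on each path (`bc`, `cb`, `ext`), both targets acquire a single
`swap`, from the closing or from the residual, and equality persists. With two bound steps a free
braid must cross the binder. -/
theorem nu {k : ActConcur a a'} {R : Proc (Γ + 1 + (a.ren push).size)}
    {R' : Proc (Γ + 1 + (a'.ren push).size)} {r : Residuals (k.ren push) R R'} {l : List Step}
    (h : r.Cofinal l) : r.nu.Cofinal (.nu :: l) := by
  obtain ⟨γ, hγ⟩ := h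
  cases k with
  | cc => exact ⟨⟨congrArg Proc.nu γ.down⟩, trivial⟩
  | bc => exact ⟨⟨congrArg (fun X => Proc.nu (Proc.ren swap X)) γ.down⟩, trivial⟩
  | cb => exact ⟨⟨congrArg (fun X => Proc.nu (Proc.ren swap X)) γ.down⟩, trivial⟩
  | bb => exact ⟨⟨FreeBraid.nu γ.down⟩, trivial⟩
  | ext => exact ⟨⟨congrArg (fun X => Proc.nu (Proc.ren swap X)) γ.down⟩, trivial⟩
  | nn => exact ⟨BoundBraid.nu γ, congrArg _ hγ⟩

end Residuals.Cofinal

theorem Concur.cofinal {Γ : ℕ} {P : Proc Γ} {a a' : Act Γ} {R : Proc (Γ + a.size)}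
    {R' : Proc (Γ + a'.size)} {k : ActConcur a a'} {t : Trans P a R} {t' : Trans P a' R'}
    (h : Concur k t t') : h.residuals.Cofinal h.position := by
  induction h with
  | symm h ih => exact ih.symm
  | parRL t u => exact .parRL t u _
  | choiceL h Q ih => exact ih
  | choiceR P h ih => exact ih
  | rep h ih => exact ih
  | parLL h Q ih => exact ih.parL Q
  | parRR P h ih => exact ih.parR P
  | nu_nu h ih => exact ih.nu
  | extrude_extrude h ih => exact ih
  | extrude_nu_c h ih => exact ih
  | extrude_nu_b h ih =>
    obtain ⟨⟨e⟩, -⟩ := ih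
    -- The premise gives an equality but a free braid is due, since the opened binder is now a
    -- second free index. The `swap` in the residual of the extrusion cancels the one in the braid.
    exact ⟨⟨e.trans (Proc.swap_swap _).symm⟩, trivial⟩
  | parL_tauL_b h u ih =>
    obtain ⟨⟨e⟩, -⟩ := ih
    exact ⟨⟨congrArg₂ Proc.par (e.pop_push _) rfl⟩, trivial⟩
  | parL_tauL_c h u ih =>
    obtain ⟨⟨e⟩, -⟩ := ih
    exact ⟨⟨congrArg (fun X => Proc.par (Proc.ren (pop _) X) _) e⟩, trivial⟩
  | parL_tauR_b h u ih =>
    obtain ⟨⟨e⟩, -⟩ := ih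
    -- The receiver takes no part in the bound action: instantiating it commutes with shifting it.
    exact ⟨⟨congrArg₂ Proc.par e (Proc.ren_pop push _ _)⟩, trivial⟩
  | parL_tauR_c h u ih =>
    obtain ⟨⟨e⟩, -⟩ := ih
    exact ⟨⟨congrArg₂ Proc.par e rfl⟩, trivial⟩
  | parR_tauL_b t h ih =>
    obtain ⟨⟨e⟩, -⟩ := ih
    exact ⟨⟨congrArg₂ Proc.par (Proc.ren_pop push _ _) e⟩, trivial⟩
  | parR_tauL_c t h ih =>
    obtain ⟨⟨e⟩, -⟩ := ih
    exact ⟨⟨congrArg (Proc.par _) e⟩, trivial⟩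
  | parR_tauR_b t h ih =>
    obtain ⟨⟨e⟩, -⟩ := ih
    exact ⟨⟨congrArg (Proc.par _) (e.pop_push _)⟩, trivial⟩
  | parR_tauR_c t h ih =>
    obtain ⟨⟨e⟩, -⟩ := ih
    exact ⟨⟨congrArg (fun X => Proc.par _ (Proc.ren (pop _) X)) e⟩, trivial⟩
  | parL_nuL_b h u ih =>
    obtain ⟨⟨e⟩, -⟩ := ih
    -- An equality is required: closing `ν` after a bound action renames the body by `swap`, which
    -- is exactly the renaming in the free braid of the bodies.
    exact ⟨⟨congrArg Proc.nu (e.par (.lift_push_push _))⟩, trivial⟩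
  | parL_nuL_c h u ih =>
    obtain ⟨⟨e⟩, -⟩ := ih
    exact ⟨⟨congrArg (fun X => Proc.nu (Proc.par X _)) e⟩, trivial⟩
  | parL_nuR_b h u ih =>
    obtain ⟨⟨e⟩, -⟩ := ih
    exact ⟨⟨congrArg Proc.nu (e.par (.lift_push_push _))⟩, trivial⟩
  | parL_nuR_ext h u ih =>
    obtain ⟨⟨e⟩, -⟩ := ih
    -- The binder is already open as index 0, so the later synchronisation transmits 0: shifting the
    -- receiver beneath its input variable and instantiating that variable with 0 cancel out.
    exact ⟨⟨congrArg₂ Proc.par e (Proc.lift_push_pop_zero _)⟩, trivial⟩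
  | parL_nuR_c h u ih =>
    obtain ⟨⟨e⟩, -⟩ := ih
    exact ⟨⟨congrArg (fun X => Proc.nu (Proc.par X _)) e⟩, trivial⟩
  | parR_nuL_b t h ih =>
    obtain ⟨⟨e⟩, -⟩ := ih
    exact ⟨⟨congrArg Proc.nu (FreeBraid.par (.lift_push_push _) e)⟩, trivial⟩
  | parR_nuL_ext t h ih =>
    obtain ⟨⟨e⟩, -⟩ := ih
    exact ⟨⟨congrArg₂ Proc.par (Proc.lift_push_pop_zero _) e⟩, trivial⟩
  | parR_nuL_c t h ih =>
    obtain ⟨⟨e⟩, -⟩ := ih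
    exact ⟨⟨congrArg (fun X => Proc.nu (Proc.par _ X)) e⟩, trivial⟩
  | parR_nuR_b t h ih =>
    obtain ⟨⟨e⟩, -⟩ := ih
    exact ⟨⟨congrArg Proc.nu (FreeBraid.par (.lift_push_push _) e)⟩, trivial⟩
  | parR_nuR_c t h ih =>
    obtain ⟨⟨e⟩, -⟩ := ih
    exact ⟨⟨congrArg (fun X => Proc.nu (Proc.par _ X)) e⟩, trivial⟩
  | tauL_tauL h g ih ig =>
    obtain ⟨⟨e⟩, -⟩ := ih
    obtain ⟨⟨f⟩, -⟩ := ig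
    -- Both input variables are instantiated, in opposite orders, which absorbs the braid.
    exact ⟨⟨congrArg₂ Proc.par (e.lift_pop_pop _ _) f⟩, trivial⟩
  | tauR_tauR h g ih ig =>
    obtain ⟨⟨e⟩, -⟩ := ih
    obtain ⟨⟨f⟩, -⟩ := ig
    exact ⟨⟨congrArg₂ Proc.par e (f.lift_pop_pop _ _)⟩, trivial⟩
  | tauL_tauR h g ih ig =>
    obtain ⟨⟨e⟩, -⟩ := ih
    obtain ⟨⟨f⟩, -⟩ := ig
    exact ⟨⟨congrArg₂ Proc.par (congrArg (Proc.ren (pop _)) e)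
      (congrArg (Proc.ren (pop _)) f)⟩, trivial⟩
  | tauL_nuL h g ih ig =>
    obtain ⟨⟨e⟩, -⟩ := ih
    obtain ⟨⟨f⟩, -⟩ := ig
    exact ⟨⟨congrArg Proc.nu (congrArg₂ Proc.par (e.lift_pop _) f)⟩, trivial⟩
  | tauR_nuL h g ih ig =>
    obtain ⟨⟨e⟩, -⟩ := ih
    obtain ⟨⟨f⟩, -⟩ := ig
    exact ⟨⟨congrArg Proc.nu (congrArg₂ Proc.par e (f.lift_pop _))⟩, trivial⟩
  | tauL_nuR h g ih ig =>
    obtain ⟨⟨e⟩, -⟩ := ih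
    obtain ⟨⟨f⟩, -⟩ := ig
    exact ⟨⟨congrArg Proc.nu (congrArg₂ Proc.par (e.lift_pop _) f)⟩, trivial⟩
  | tauR_nuR h g ih ig =>
    obtain ⟨⟨e⟩, -⟩ := ih
    obtain ⟨⟨f⟩, -⟩ := ig
    exact ⟨⟨congrArg Proc.nu (congrArg₂ Proc.par e (f.lift_pop _))⟩, trivial⟩
  | nuL_nuL h g ih ig =>
    obtain ⟨⟨e⟩, -⟩ := ih
    obtain ⟨⟨f⟩, -⟩ := ig
    -- Both fresh indices of the freely braided bodies are now restricted, so the braid becomes the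
    -- axiom at the root, hence the empty position.
    exact ⟨BoundBraid.nuSwap (e.par f), rfl⟩
  | nuR_nuR h g ih ig =>
    obtain ⟨⟨e⟩, -⟩ := ih
    obtain ⟨⟨f⟩, -⟩ := ig
    exact ⟨BoundBraid.nuSwap (e.par f), rfl⟩
  | nuL_nuR h g ih ig =>
    obtain ⟨⟨e⟩, -⟩ := ih
    obtain ⟨⟨f⟩, -⟩ := ig
    exact ⟨BoundBraid.nuSwap (e.par f), rfl⟩
  | nuL_nuL_ext h g ih ig =>
    obtain ⟨⟨e⟩, -⟩ := ih
    obtain ⟨⟨f⟩, -⟩ := ig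
    -- Only one binder is extruded, so both inputs receive the same name 0 and their order is lost;
    -- no bound braid remains.
    exact ⟨⟨congrArg Proc.nu (congrArg₂ Proc.par e.pop_zero f)⟩, trivial⟩
  | nuR_nuR_ext h g ih ig =>
    obtain ⟨⟨e⟩, -⟩ := ih
    obtain ⟨⟨f⟩, -⟩ := ig
    exact ⟨⟨congrArg Proc.nu (congrArg₂ Proc.par e f.pop_zero)⟩, trivial⟩

end PiCalc

theorem mainTheorem1 {Γ : ℕ} {P : PiCalc.Proc Γ} {a a' : PiCalc.Act Γ}
    {R : PiCalc.Proc (Γ + a.size)} {R' : PiCalc.Proc (Γ + a'.size)}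
    (k : PiCalc.ActConcur a a') (t : PiCalc.Trans P a R) (t' : PiCalc.Trans P a' R')
    (h : PiCalc.Concur k t t') :
    ∃! γ : PiCalc.Braiding k h.residuals.tgt' h.residuals.tgt, γ.At h.position := by
  obtain ⟨γ, hγ⟩ := h.cofinal
  exact ⟨γ, hγ, fun _ hδ => PiCalc.Braiding.At.unique hδ hγ⟩
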